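/- Let $N\ge 1$ be an integer, let $\alpha>0$ and let $\omega\in\mathbb R$ satisfy $\omega/\alpha\ge \tfrac12$. Let $u,v\in C^2(\mathbb R^N)$ be functions with $u>0$ and $v>0$ everywhere that satisfy $$ \begin{cases} \Delta u=-u(1-u^2-v^2)-v(\omega-\alpha uv) & \text{in }\mathbb R^N,\\ \Delta v=-v(1-u^2-v^2)-u(\omega-\alpha uv) & \text{in }\mathbb R^N. \end{cases} $$ Then $(u,v)$ is identically equal to $(c,c)$, where $c=\sqrt{\frac{1+\omega}{2+\alpha}}$. -/

import Mathlib

/-- `(u, v)` is a positive regular (classical, `C²`) solution on `ℝᴺ` of the system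
`Δ u = -u (1 - u² - v²) - v (ω - α u v)`, `Δ v = -v (1 - u² - v²) - u (ω - α u v)`. -/
structure IsPositiveRegularSolution (N : ℕ) (α ω : ℝ)
    (u v : EuclideanSpace ℝ (Fin N) → ℝ) : Prop where
  contDiff_fst : ContDiff ℝ 2 u
  contDiff_snd : ContDiff ℝ 2 v
  pos_fst : ∀ x, 0 < u x
  pos_snd : ∀ x, 0 < v x
  laplacian_fst : ∀ x, Laplacian.laplacian u x =
    -u x * (1 - u x ^ 2 - v x ^ 2) - v x * (ω - α * u x * v x)
  laplacian_snd : ∀ x, Laplacian.laplacian v x =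
    -v x * (1 - u x ^ 2 - v x ^ 2) - u x * (ω - α * u x * v x)

open Filter Topology

/-! Put `s = u + v` and `d = u - v`. Then `Δs = s (u² + v² + αuv - 1 - ω)` and `Δd = d (u² + v² -
αuv - 1 + ω)`. A Keller–Osserman barrier bounds `s` above, and a compactly supported barrier bounds
it below by a positive constant, so extrema can be handled by a maximum principle at infinity.

Let `S = sup s` and `Φ = sup |d| / s`. Almost-maximum points of `±d - Φ s` force `ω ≤ αuv` in the
limit, and `4uv = s² - d²` turns this into `4ω ≤ α S² (1 - Φ²)` (`four_mul_le_of_ratio_sup`).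
Almost-maximum points of `s` give `S² (2 + α - Φ² γ) ≤ 4 (1 + ω)` with `γ = max (α - 2) 0`
(`sq_mul_le_of_isLUB_add`). If `Φ > 0`, the two are incompatible with `α ≤ 2ω`; hence `u = v`. On
the diagonal the bounds for `sup s` and `inf s` coincide, so `s` is constant. -/

theorem IsLocalMax.deriv_deriv_nonpos {f : ℝ → ℝ} {a : ℝ} (h : IsLocalMax f a)
    (hc : ContinuousAt f a) : deriv (deriv f) a ≤ 0 := by
  by_contra! hpos
  have hmin := isLocalMin_of_deriv_deriv_pos hpos h.deriv_eq_zero hc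
  have hconst : f =ᶠ[𝓝 a] fun _ => f a := by
    filter_upwards [h, hmin] with x h1 h2 using le_antisymm h1 h2
  have h0 : deriv (deriv f) a = 0 := by
    rw [hconst.deriv.deriv_eq]
    simp
  exact hpos.ne' h0

/-! ### Laplacians along orthonormal lines, touching functions and radial barriers. -/

section InnerProductSpace

variable {E : Type*} [NormedAddCommGroup E] [InnerProductSpace ℝ E]

theorem ContDiffAt.deriv_deriv_line {f : E → ℝ} {x : E} (hf : ContDiffAt ℝ 2 f x) (e : E) :
    deriv (deriv fun t : ℝ => f (x + t • e)) 0 = iteratedFDeriv ℝ 2 f x ![e, e] := by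
  have hline : ∀ t : ℝ, HasDerivAt (fun t : ℝ => x + t • e) e t := fun t => by
    simpa using ((hasDerivAt_id t).smul_const e).const_add x
  have htend : Tendsto (fun t : ℝ => x + t • e) (𝓝 0) (𝓝 x) := by
    simpa using (hline 0).continuousAt.tendsto
  have hd : ∀ᶠ z in 𝓝 x, DifferentiableAt ℝ f z := by
    filter_upwards [hf.eventually (by simp)] with z hz using hz.differentiableAt (by simp)
  have h1 : (deriv fun t : ℝ => f (x + t • e)) =ᶠ[𝓝 0] fun t => fderiv ℝ f (x + t • e) e := by
    filter_upwards [htend.eventually hd] with t ht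
    exact (ht.hasFDerivAt.comp_hasDerivAt t (hline t)).deriv
  have h2 : DifferentiableAt ℝ (fderiv ℝ f) (x + (0 : ℝ) • e) := by
    simpa using (hf.fderiv_right (m := 1) (by norm_num)).differentiableAt (by simp)
  rw [h1.deriv_eq, iteratedFDeriv_two_apply]
  have h3 : HasDerivAt (fun t : ℝ => fderiv ℝ f (x + t • e))
      (fderiv ℝ (fderiv ℝ f) (x + (0 : ℝ) • e) e) 0 :=
    HasFDerivAt.comp_hasDerivAt (f := fun t : ℝ => x + t • e) 0 h2.hasFDerivAt (hline 0)
  have h4 : HasDerivAt (fun t : ℝ => fderiv ℝ f (x + t • e) e)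
      (fderiv ℝ (fderiv ℝ f) (x + (0 : ℝ) • e) e e) 0 := by
    simpa using h3.clm_apply (hasDerivAt_const (0 : ℝ) e)
  rw [h4.deriv]
  simp

variable [FiniteDimensional ℝ E]

theorem ContDiffAt.laplacian_eq_sum_deriv_deriv {f : E → ℝ} {x : E} (hf : ContDiffAt ℝ 2 f x) :
    Laplacian.laplacian f x =
      ∑ i, deriv (deriv fun t : ℝ => f (x + t • stdOrthonormalBasis ℝ E i)) 0 := by
  rw [InnerProductSpace.laplacian_eq_iteratedFDeriv_stdOrthonormalBasis]
  exact Finset.sum_congr rfl fun i _ => (hf.deriv_deriv_line _).symm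

theorem IsLocalMax.laplacian_nonpos {f : E → ℝ} {x : E} (h : IsLocalMax f x)
    (hf : ContDiffAt ℝ 2 f x) : Laplacian.laplacian f x ≤ 0 := by
  rw [hf.laplacian_eq_sum_deriv_deriv]
  refine Finset.sum_nonpos fun i _ => ?_
  have hc : ContinuousAt (fun t : ℝ => x + t • stdOrthonormalBasis ℝ E i) 0 := by fun_prop
  refine IsLocalMax.deriv_deriv_nonpos ?_ ?_
  · have := hc.eventually (p := fun z => f z ≤ f x) (by simpa [IsLocalMax, IsMaxFilter] using h)
    simpa [IsLocalMax, IsMaxFilter] using this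
  · exact ContinuousAt.comp' (by simpa using hf.continuousAt) hc

theorem laplacian_le_of_eventually_le {f b : E → ℝ} {x : E} (hf : ContDiffAt ℝ 2 f x)
    (hb : ContDiffAt ℝ 2 b x) (hle : ∀ᶠ z in 𝓝 x, f z ≤ b z) (heq : f x = b x) :
    Laplacian.laplacian f x ≤ Laplacian.laplacian b x := by
  have hmax : IsLocalMax (f - b) x := by
    filter_upwards [hle] with z hz
    simpa [heq] using hz
  have := hmax.laplacian_nonpos (hf.sub hb)
  rw [hf.laplacian_sub hb] at this
  linarith

/-- The Laplacian of a radial function, written through `τ = ‖z - y‖ ^ 2`. -/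
theorem laplacian_comp_norm_sub_sq {g g' : ℝ → ℝ} {g'' : ℝ} {x y : E}
    (hc : ContDiffAt ℝ 2 g (‖x - y‖ ^ 2))
    (hg : ∀ᶠ τ in 𝓝 (‖x - y‖ ^ 2), HasDerivAt g (g' τ) τ)
    (hg' : HasDerivAt g' g'' (‖x - y‖ ^ 2)) :
    Laplacian.laplacian (fun z => g (‖z - y‖ ^ 2)) x =
      4 * ‖x - y‖ ^ 2 * g'' + 2 * Module.finrank ℝ E * g' (‖x - y‖ ^ 2) := by
  have hC : ContDiffAt ℝ 2 (fun z => g (‖z - y‖ ^ 2)) x := by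
    refine ContDiffAt.comp (f := fun z : E => ‖z - y‖ ^ 2) x hc ?_
    exact ((contDiff_id.sub contDiff_const).norm_sq ℝ).contDiffAt
  rw [hC.laplacian_eq_sum_deriv_deriv]
  have key : ∀ i, deriv (deriv fun t : ℝ =>
      g (‖x + t • stdOrthonormalBasis ℝ E i - y‖ ^ 2)) 0 =
      4 * g'' * inner ℝ (x - y) (stdOrthonormalBasis ℝ E i) ^ 2 + 2 * g' (‖x - y‖ ^ 2) := by
    intro i
    set e := stdOrthonormalBasis ℝ E i with he
    have hne : ‖e‖ = 1 := (stdOrthonormalBasis ℝ E).norm_eq_one i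
    set p : ℝ → ℝ := fun t => ‖x - y‖ ^ 2 + 2 * inner ℝ (x - y) e * t + t ^ 2 with hp
    have hrw : (fun t : ℝ => g (‖x + t • e - y‖ ^ 2)) = fun t => g (p t) := by
      ext t
      rw [show x + t • e - y = (x - y) + t • e by abel, norm_add_sq_real, norm_smul, hne,
        inner_smul_right]
      congr 1
      simp [hp]
      ring
    have hpd : ∀ t, HasDerivAt p (2 * inner ℝ (x - y) e + 2 * t) t := fun t => by
      have := (((hasDerivAt_id' t).const_mul (2 * inner ℝ (x - y) e)).const_add
        (‖x - y‖ ^ 2)).fun_add ((hasDerivAt_id' t).fun_pow 2)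
      simpa using this
    have hp0 : p 0 = ‖x - y‖ ^ 2 := by simp [hp]
    have htend : Tendsto p (𝓝 0) (𝓝 (‖x - y‖ ^ 2)) := hp0 ▸ (hpd 0).continuousAt.tendsto
    rw [hrw]
    have h1 : (deriv fun t => g (p t)) =ᶠ[𝓝 0]
        fun t => g' (p t) * (2 * inner ℝ (x - y) e + 2 * t) := by
      filter_upwards [htend.eventually hg] with t ht
      exact (ht.comp t (hpd t)).deriv
    rw [h1.deriv_eq]
    have h2 : HasDerivAt (fun t => g' (p t)) (g'' * (2 * inner ℝ (x - y) e + 2 * 0)) 0 :=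
      HasDerivAt.comp 0 (hp0 ▸ hg') (hpd 0)
    have h3 : HasDerivAt (fun t : ℝ => 2 * inner ℝ (x - y) e + 2 * t) 2 0 := by
      simpa using ((hasDerivAt_id (0 : ℝ)).const_mul 2).const_add (2 * inner ℝ (x - y) e)
    rw [(h2.fun_mul h3).deriv, hp0]
    ring
  rw [Finset.sum_congr rfl fun i _ => key i, Finset.sum_add_distrib, ← Finset.mul_sum,
    OrthonormalBasis.sum_sq_inner_left]
  simp
  ring

end InnerProductSpace

/-! ### Maximum principle at infinity and a priori bounds by barriers. -/

section MaximumPrinciple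

variable {E : Type*} [NormedAddCommGroup E] [InnerProductSpace ℝ E] [FiniteDimensional ℝ E]

/-- Maximum principle at infinity: a `C²` function bounded above has almost-maximum points at which
its Laplacian is almost nonpositive. -/
theorem ContDiff.exists_le_and_laplacian_le {f : E → ℝ} (hf : ContDiff ℝ 2 f) {K : ℝ}
    (hK : ∀ x, f x ≤ K) (y : E) {ε : ℝ} (hε : 0 < ε) :
    ∃ x, f y ≤ f x ∧ Laplacian.laplacian f x ≤ ε := by
  set n : ℝ := (Module.finrank ℝ E : ℝ) with hn
  have hn0 : 0 ≤ n := by positivity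
  -- The penalty `η ‖x - y‖²` has Laplacian `2nη ≤ ε`; the `+ 1` keeps the quotient meaningful when
  -- `n = 0`.
  set η : ℝ := ε / (2 * n + 1) with hη
  have hη0 : 0 < η := by positivity
  have hηε : 2 * n * η ≤ ε := by
    rw [hη, mul_div_assoc', div_le_iff₀ (by positivity)]
    nlinarith
  have hcont : Continuous fun x => f x - η * ‖x - y‖ ^ 2 := by
    have := hf.continuous
    fun_prop
  have hfar : ∀ᶠ x in cocompact E, f x - η * ‖x - y‖ ^ 2 ≤ f y - η * ‖y - y‖ ^ 2 := by
    filter_upwards [(tendsto_dist_right_cocompact_atTop y).eventually_ge_atTop ((K - f y) / η + 1)]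
      with x hx
    rw [dist_eq_norm] at hx
    have h1 : 0 ≤ (K - f y) / η := div_nonneg (sub_nonneg.2 (hK y)) hη0.le
    have h2 : (K - f y) / η ≤ ‖x - y‖ ^ 2 := by nlinarith
    rw [div_le_iff₀ hη0] at h2
    have := hK x
    simp
    linarith
  obtain ⟨x, hx⟩ := hcont.exists_forall_ge' y hfar
  refine ⟨x, ?_, ?_⟩
  · have := hx y
    simp at this
    nlinarith [sq_nonneg ‖x - y‖]
  set g : ℝ → ℝ := fun τ => f x + η * (τ - ‖x - y‖ ^ 2) with hg
  have hgc : ContDiff ℝ 2 g := by fun_prop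
  have hgd : ∀ τ, HasDerivAt g η τ := fun τ => by
    convert! (((hasDerivAt_id' τ).sub_const (‖x - y‖ ^ 2)).const_mul η).const_add (f x) using 1
    ring
  have hb : ContDiff ℝ 2 fun z => g (‖z - y‖ ^ 2) :=
    hgc.comp ((contDiff_id.sub contDiff_const).norm_sq ℝ)
  have hle : Laplacian.laplacian f x ≤ Laplacian.laplacian (fun z => g (‖z - y‖ ^ 2)) x := by
    refine laplacian_le_of_eventually_le hf.contDiffAt hb.contDiffAt
      (Eventually.of_forall fun z => ?_) (by simp [hg])
    have := hx z
    simp only [hg]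
    linarith
  rw [laplacian_comp_norm_sub_sq hgc.contDiffAt (Eventually.of_forall hgd)
    (hasDerivAt_const _ η)] at hle
  linarith

/-- Keller–Osserman bound for a cubic absorption term. -/
theorem ContDiff.sq_le_of_cubic_le_laplacian {s : E → ℝ} (hs : ContDiff ℝ 2 s) (hpos : ∀ x, 0 < s x)
    {k : ℝ} (hk : 0 ≤ k)
    (hΔ : ∀ x, s x * (s x ^ 2 / 2 - k) ≤ Laplacian.laplacian s x) (y : E) :
    s y ^ 2 ≤ 2 * k + 16 + 4 * Module.finrank ℝ E := by
  have hcont : Continuous fun z => s z * (1 - ‖z - y‖ ^ 2) := by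
    have := hs.continuous
    fun_prop
  obtain ⟨x, hxmem, hx⟩ := (isCompact_closedBall y 1).exists_isMaxOn
    ⟨y, Metric.mem_closedBall_self zero_le_one⟩ hcont.continuousOn
  set n : ℝ := (Module.finrank ℝ E : ℝ) with hn
  have hn0 : 0 ≤ n := by positivity
  set M : ℝ := s x * (1 - ‖x - y‖ ^ 2) with hM
  have hMy : s y ≤ M := by
    have : s y * (1 - ‖y - y‖ ^ 2) ≤ M := hx (Metric.mem_closedBall_self zero_le_one)
    simpa using this
  have hM0 : 0 < M := (hpos y).trans_le hMy
  set t : ℝ := 1 - ‖x - y‖ ^ 2 with ht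
  have ht0 : 0 < t := pos_of_mul_pos_right hM0 (hpos x).le
  have hr0 : 0 ≤ ‖x - y‖ ^ 2 := by positivity
  have ht1 : t ≤ 1 := by linarith
  have hlt : ‖x - y‖ ^ 2 < 1 := by linarith
  -- At the maximum of `s (1 - ‖z - y‖²)`, the function `M / (1 - ‖z - y‖²)`, infinite on the unit
  -- sphere, touches `s` from above.
  set g : ℝ → ℝ := fun τ => M / (1 - τ) with hg
  have hsub : ∀ τ : ℝ, HasDerivAt (fun τ : ℝ => 1 - τ) (-1) τ := fun τ => by
    simpa using (hasDerivAt_id' τ).const_sub 1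
  have hgd : ∀ᶠ τ in 𝓝 (‖x - y‖ ^ 2), HasDerivAt g (M / (1 - τ) ^ 2) τ := by
    filter_upwards [eventually_lt_nhds hlt] with τ hτ
    have h1 : (1 : ℝ) - τ ≠ 0 := by linarith
    convert! (hasDerivAt_const τ M).fun_div (hsub τ) h1 using 1
    ring
  have hgd' : HasDerivAt (fun τ => M / (1 - τ) ^ 2) (2 * M / t ^ 3) (‖x - y‖ ^ 2) := by
    have h1 : ((1 : ℝ) - ‖x - y‖ ^ 2) ^ 2 ≠ 0 := by rw [← ht]; positivity
    convert! (hasDerivAt_const (‖x - y‖ ^ 2) M).fun_div ((hsub _).fun_pow 2) h1 using 1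
    rw [← ht]
    field_simp
    ring
  have hgc : ContDiffAt ℝ 2 g (‖x - y‖ ^ 2) :=
    contDiffAt_const.div (contDiffAt_const.sub contDiffAt_id) (by simpa [← ht] using ht0.ne')
  have hbc : ContDiffAt ℝ 2 (fun z => g (‖z - y‖ ^ 2)) x :=
    ContDiffAt.comp (f := fun z : E => ‖z - y‖ ^ 2) x hgc
      ((contDiff_id.sub contDiff_const).norm_sq ℝ).contDiffAt
  have hle : Laplacian.laplacian s x ≤ Laplacian.laplacian (fun z => g (‖z - y‖ ^ 2)) x := by
    refine laplacian_le_of_eventually_le hs.contDiffAt hbc ?_ ?_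
    · have hc : ContinuousAt (fun z : E => ‖z - y‖ ^ 2) x := by fun_prop
      filter_upwards [hc.eventually_lt_const hlt] with z hz
      have hzb : z ∈ Metric.closedBall y 1 := by
        rw [mem_closedBall_iff_norm]
        nlinarith [norm_nonneg (z - y)]
      rw [hg, le_div_iff₀ (by linarith)]
      exact hx hzb
    · simp only [hg, ← ht, hM]
      field_simp
  rw [laplacian_comp_norm_sub_sq hgc hgd hgd', ← ht] at hle
  have h := (hΔ x).trans hle
  have hsx : s x = M / t := by rw [hM]; field_simp
  have hr : ‖x - y‖ ^ 2 = 1 - t := by rw [ht]; ring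
  rw [hsx, hr] at h
  have h2 : M * (M ^ 2 / 2 - k * t ^ 2) ≤ M * (8 * (1 - t) + 2 * n * t) := by
    have e1 : M * (M ^ 2 / 2 - k * t ^ 2) = (M / t * ((M / t) ^ 2 / 2 - k)) * t ^ 3 := by
      field_simp
    have e2 : M * (8 * (1 - t) + 2 * n * t) =
        (4 * (1 - t) * (2 * M / t ^ 3) + 2 * n * (M / t ^ 2)) * t ^ 3 := by
      field_simp
      ring
    rw [e1, e2]
    exact mul_le_mul_of_nonneg_right h (by positivity)
  have h3 := le_of_mul_le_mul_left h2 hM0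
  have h4 : k * t ^ 2 ≤ k := by nlinarith [mul_nonneg hk (by nlinarith : 0 ≤ 1 - t ^ 2)]
  have h5 : n * t ≤ n := by nlinarith
  nlinarith [hpos y]

/-- Uniform lower bound for a positive function which is a strict supersolution where it is small. -/
theorem ContDiff.le_of_laplacian_le_neg_mul {s : E → ℝ} (hs : ContDiff ℝ 2 s)
    (hpos : ∀ x, 0 < s x) {k δ : ℝ} (hk : 0 < k)
    (hΔ : ∀ x, s x ≤ δ → Laplacian.laplacian s x ≤ -k * s x) (y : E) : δ ≤ s y := by
  set n : ℝ := (Module.finrank ℝ E : ℝ) with hn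
  have hn0 : 0 ≤ n := by positivity
  -- The radius is large enough that the quadratic `k t² - (4n + 8) t + 8ρ²` has negative
  -- discriminant.
  obtain ⟨ρ, hρ0, hρ⟩ : ∃ ρ : ℝ, 0 < ρ ∧ (4 * n + 8) ^ 2 < 32 * k * ρ ^ 2 := by
    refine ⟨(4 * n + 8) ^ 2 / (32 * k) + 1, by positivity, ?_⟩
    set a := (4 * n + 8) ^ 2 / (32 * k) with ha
    have ha0 : 0 ≤ a := by positivity
    have : (4 * n + 8) ^ 2 = 32 * k * a := by rw [ha]; field_simp
    rw [this]
    gcongr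
    nlinarith
  set g : ℝ → ℝ := fun τ => (ρ ^ 2 - τ) ^ 2 with hg
  have hsub : ∀ τ : ℝ, HasDerivAt (fun τ : ℝ => ρ ^ 2 - τ) (-1) τ := fun τ => by
    simpa using (hasDerivAt_id' τ).const_sub (ρ ^ 2)
  have hgd : ∀ τ, HasDerivAt g (-2 * (ρ ^ 2 - τ)) τ := fun τ => by
    convert! (hsub τ).fun_pow 2 using 1
    ring
  have hgd' : ∀ τ, HasDerivAt (fun τ => -2 * (ρ ^ 2 - τ)) 2 τ := fun τ => by
    convert! (hsub τ).const_mul (-2) using 1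
    ring
  have hgc : ContDiff ℝ 2 g := by fun_prop
  have hψ : ContDiff ℝ 2 fun z => g (‖z - y‖ ^ 2) :=
    hgc.comp ((contDiff_id.sub contDiff_const).norm_sq ℝ)
  have hcont : Continuous fun z => g (‖z - y‖ ^ 2) / s z :=
    hψ.continuous.div hs.continuous fun z => (hpos z).ne'
  have hymem := Metric.mem_closedBall_self (x := y) hρ0.le
  obtain ⟨x, hxmem, hx⟩ := (isCompact_closedBall y ρ).exists_isMaxOn ⟨y, hymem⟩ hcont.continuousOn
  -- `L` is the least multiple for which `L s` dominates the barrier on the ball; the two touch at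
  -- `x`.
  set L : ℝ := g (‖x - y‖ ^ 2) / s x with hL
  have hLx : g (‖x - y‖ ^ 2) = L * s x := by
    rw [hL]
    have := (hpos x).ne'
    field_simp
  have hball : ∀ z ∈ Metric.closedBall y ρ, g (‖z - y‖ ^ 2) ≤ L * s z := fun z hz => by
    have : g (‖z - y‖ ^ 2) / s z ≤ L := hx hz
    rwa [div_le_iff₀ (hpos z)] at this
  have hLy : ρ ^ 4 ≤ L * s y := by
    have := hball y hymem
    simp only [hg, sub_self, norm_zero] at this
    linarith [this]
  have hL0 : 0 < L := pos_of_mul_pos_left ((by positivity : 0 < ρ ^ 4).trans_le hLy) (hpos y).le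
  set t : ℝ := ρ ^ 2 - ‖x - y‖ ^ 2 with ht
  have hgx : g (‖x - y‖ ^ 2) = t ^ 2 := rfl
  have hnorm : ‖x - y‖ ≤ ρ := mem_closedBall_iff_norm.1 hxmem
  have ht0 : 0 < t := by
    have h1 : 0 ≤ t := by nlinarith [norm_nonneg (x - y)]
    rcases h1.eq_or_lt with h1 | h1
    · rw [hgx, ← h1] at hLx
      have := mul_pos hL0 (hpos x)
      norm_num at hLx
      rcases hLx with h | h
      · exact absurd h hL0.ne'
      · exact absurd h (hpos x).ne'
    · exact h1
  have hlt : ‖x - y‖ ^ 2 < ρ ^ 2 := by linarith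
  have hle : Laplacian.laplacian (fun z => g (‖z - y‖ ^ 2)) x ≤
      Laplacian.laplacian (L • s) x := by
    refine laplacian_le_of_eventually_le hψ.contDiffAt (hs.const_smul L).contDiffAt ?_ hLx
    have hc : ContinuousAt (fun z : E => ‖z - y‖ ^ 2) x := by fun_prop
    filter_upwards [hc.eventually_lt_const hlt] with z hz
    refine hball z (mem_closedBall_iff_norm.2 ?_)
    exact (lt_of_pow_lt_pow_left₀ 2 hρ0.le hz).le
  rw [laplacian_comp_norm_sub_sq hgc.contDiffAt (Eventually.of_forall hgd) (hgd' _),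
    InnerProductSpace.laplacian_smul L hs.contDiffAt, smul_eq_mul, ← ht] at hle
  have hsx : δ < s x := by
    by_contra! hcon
    have h1 := mul_le_mul_of_nonneg_left (hΔ x hcon) hL0.le
    have h2 : L * (-k * s x) = -k * t ^ 2 := by rw [← hgx, hLx]; ring
    have hr : ‖x - y‖ ^ 2 = ρ ^ 2 - t := by rw [ht]; ring
    rw [hr] at hle
    have h3 : k * t ^ 2 - (4 * n + 8) * t + 8 * ρ ^ 2 ≤ 0 := by linarith
    nlinarith [sq_nonneg (2 * k * t - (4 * n + 8))]
  -- The barrier peaks at the centre, so `L * s x ≤ ρ ^ 4 ≤ L * s y`: the bound at `x` passes to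
  -- `y`.
  by_contra! hcon
  have h1 : L * s x ≤ ρ ^ 4 := by
    rw [← hLx, hgx]
    have : t ≤ ρ ^ 2 := by nlinarith [sq_nonneg ‖x - y‖]
    nlinarith
  have h2 : L * s y < L * s x := by gcongr; linarith
  linarith

end MaximumPrinciple

theorem le_of_forall_le_add_mul {a b c : ℝ} (h : ∀ ε, 0 < ε → a ≤ b + c * ε) : a ≤ b := by
  have hc : Tendsto (fun ε : ℝ => b + c * ε) (𝓝[>] 0) (𝓝 b) := by
    have : ContinuousAt (fun ε : ℝ => b + c * ε) 0 := by fun_prop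
    simpa using this.tendsto.mono_left nhdsWithin_le_nhds
  exact ge_of_tendsto hc (by filter_upwards [self_mem_nhdsWithin] with ε hε using h ε hε)

/-! ### Equations and two-sided bounds for the sum `u + v`. -/

namespace IsPositiveRegularSolution

variable {N : ℕ} {α ω : ℝ} {u v : EuclideanSpace ℝ (Fin N) → ℝ}

theorem swap (h : IsPositiveRegularSolution N α ω u v) : IsPositiveRegularSolution N α ω v u where
  contDiff_fst := h.contDiff_snd
  contDiff_snd := h.contDiff_fst
  pos_fst := h.pos_snd
  pos_snd := h.pos_fst
  laplacian_fst x := by rw [h.laplacian_snd]; ring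
  laplacian_snd x := by rw [h.laplacian_fst]; ring

theorem contDiff_add (h : IsPositiveRegularSolution N α ω u v) : ContDiff ℝ 2 (u + v) :=
  h.contDiff_fst.add h.contDiff_snd

theorem contDiff_sub (h : IsPositiveRegularSolution N α ω u v) : ContDiff ℝ 2 (u - v) :=
  h.contDiff_fst.sub h.contDiff_snd

theorem add_pos (h : IsPositiveRegularSolution N α ω u v) (x) : 0 < (u + v) x :=
  _root_.add_pos (h.pos_fst x) (h.pos_snd x)

theorem laplacian_add (h : IsPositiveRegularSolution N α ω u v) (x) :
    Laplacian.laplacian (u + v) x =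
      (u x + v x) * (u x ^ 2 + v x ^ 2 + α * (u x * v x) - 1 - ω) := by
  rw [h.contDiff_fst.contDiffAt.laplacian_add h.contDiff_snd.contDiffAt, h.laplacian_fst,
    h.laplacian_snd]
  ring

theorem laplacian_sub (h : IsPositiveRegularSolution N α ω u v) (x) :
    Laplacian.laplacian (u - v) x =
      (u x - v x) * (u x ^ 2 + v x ^ 2 - α * (u x * v x) - 1 + ω) := by
  rw [h.contDiff_fst.contDiffAt.laplacian_sub h.contDiff_snd.contDiffAt, h.laplacian_fst,
    h.laplacian_snd]
  ring

theorem exists_add_le (h : IsPositiveRegularSolution N α ω u v) (hα : 0 < α) (hω : 0 < ω) :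
    ∃ K, ∀ x, u x + v x ≤ K := by
  have hsq := h.contDiff_add.sq_le_of_cubic_le_laplacian h.add_pos (k := 1 + ω) (by linarith)
    fun x => by
      rw [h.laplacian_add, Pi.add_apply]
      have hu := h.pos_fst x
      have hv := h.pos_snd x
      refine mul_le_mul_of_nonneg_left ?_ (by linarith)
      nlinarith [sq_nonneg (u x - v x), mul_pos hα (mul_pos hu hv)]
  refine ⟨_, fun x => Real.le_sqrt_of_sq_le (hsq x)⟩

theorem exists_le_add (h : IsPositiveRegularSolution N α ω u v) (hα : 0 < α) (hω : 0 < ω) :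
    ∃ δ, 0 < δ ∧ ∀ x, δ ≤ u x + v x := by
  -- For `s ≤ δ ≤ 1`, `u² + v² + αuv ≤ (1 + α) s² ≤ 1/2`, so the factor of `s` in `Δs` is at most
  -- `-1/2`.
  set δ : ℝ := 1 / (2 * (1 + α)) with hδ
  have hδ0 : 0 < δ := by positivity
  have hδ1 : (1 + α) * δ = 1 / 2 := by rw [hδ]; field_simp
  have hδ2 : δ ≤ 1 := by nlinarith
  refine ⟨δ, hδ0, h.contDiff_add.le_of_laplacian_le_neg_mul h.add_pos
    (k := 1 / 2) (by norm_num) fun x hx => ?_⟩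
  rw [h.laplacian_add]
  rw [Pi.add_apply] at hx ⊢
  have hu := h.pos_fst x
  have hv := h.pos_snd x
  have h1 : (u x + v x) ^ 2 ≤ δ := by nlinarith
  have h2 : (1 + α) * (u x + v x) ^ 2 ≤ 1 / 2 := by
    rw [← hδ1]
    gcongr
  rw [mul_comm (-(1 / 2) : ℝ)]
  refine mul_le_mul_of_nonneg_left ?_ (by linarith)
  nlinarith [mul_pos hu hv, mul_nonneg hα.le (add_nonneg (sq_nonneg (u x)) (sq_nonneg (v x))),
    mul_pos hα (mul_pos hu hv)]

/-! ### Inequalities at almost-extremal points. -/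

/-- Maximum principle for `(u - v) / (u + v)`. -/
theorem four_mul_le_of_ratio_sup (h : IsPositiveRegularSolution N α ω u v) (hα : 0 < α)
    (hω : 0 < ω) {Φ S : ℝ} (hΦ0 : 0 < Φ) (hΦ1 : Φ ≤ 1) (hS : ∀ x, u x + v x ≤ S)
    (hle : ∀ x, u x - v x ≤ Φ * (u x + v x))
    (hsup : ∀ ε, 0 < ε → ∃ x, Φ * (u x + v x) - ε < u x - v x) :
    4 * ω ≤ α * (S ^ 2 * (1 - Φ ^ 2)) := by
  obtain ⟨δ, hδ0, hδ⟩ := h.exists_le_add hα hω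
  have hΦc : ContDiff ℝ 2 (Φ • (u + v)) := h.contDiff_add.const_smul Φ
  have hg : ContDiff ℝ 2 (u - v - Φ • (u + v)) := h.contDiff_sub.sub hΦc
  set A₀ : ℝ := S ^ 2 * (1 + α) + 1 + ω with hA₀
  suffices 2 * Φ * δ * (4 * ω) ≤ 2 * Φ * δ * (α * (S ^ 2 * (1 - Φ ^ 2))) from
    le_of_mul_le_mul_left this (by positivity)
  refine le_of_forall_le_add_mul (c := 4 * Φ * δ * α * S + 4 * (1 + A₀)) fun ε hε => ?_
  obtain ⟨y, hy⟩ := hsup ε hε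
  obtain ⟨x, hyx, hx⟩ := hg.exists_le_and_laplacian_le (K := 0)
    (fun x => sub_nonpos.2 (hle x)) y hε
  rw [h.contDiff_sub.contDiffAt.laplacian_sub hΦc.contDiffAt,
    InnerProductSpace.laplacian_smul Φ h.contDiff_add.contDiffAt, h.laplacian_add,
    h.laplacian_sub, smul_eq_mul] at hx
  simp only [Pi.sub_apply, Pi.smul_apply, Pi.add_apply, smul_eq_mul] at hyx
  have hu := h.pos_fst x
  have hv := h.pos_snd x
  have hxδ := hδ x
  have hxS := hS x
  have hxle := hle x
  have hxε : Φ * (u x + v x) - (u x - v x) ≤ ε := by linarith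
  generalize u x = a at *
  generalize v x = b at *
  have hab := mul_pos hu hv
  have hsq : (a + b) ^ 2 ≤ S ^ 2 := by gcongr
  have hA : |a ^ 2 + b ^ 2 - α * (a * b) - 1 + ω| ≤ A₀ := by
    have := mul_le_mul_of_nonneg_left (by nlinarith : a * b ≤ S ^ 2) hα.le
    have := mul_pos hα hab
    rw [abs_le]
    constructor <;> nlinarith [sq_nonneg a, sq_nonneg b, mul_nonneg hα.le (sq_nonneg S)]
  have hgA : (Φ * (a + b) - (a - b)) * (a ^ 2 + b ^ 2 - α * (a * b) - 1 + ω) ≤ ε * A₀ :=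
    (mul_le_mul_of_nonneg_left ((le_abs_self _).trans hA) (by linarith)).trans
      (mul_le_mul_of_nonneg_right hxε ((abs_nonneg _).trans hA))
  -- The factors of `d` in `Δd` and of `s` in `Δs` differ by `2 (ω - αuv)`; replacing `d` by `Φ s`
  -- costs at most `ε A₀`.
  have h1 : 2 * Φ * (a + b) * (ω - α * (a * b)) ≤ ε * (1 + A₀) := by linarith
  have hA0 : 0 ≤ A₀ := (abs_nonneg _).trans hA
  have h2 : 2 * Φ * δ * (ω - α * (a * b)) ≤ ε * (1 + A₀) := by
    rcases le_total 0 (ω - α * (a * b)) with h0 | h0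
    · refine le_trans ?_ h1
      gcongr
    · exact (mul_nonpos_of_nonneg_of_nonpos (by positivity) h0).trans (by positivity)
  -- `4ab = s² - d² = s² (1 - Φ²) + (Φ s - d)(Φ s + d)`, with `0 ≤ Φ s - d ≤ ε`.
  have h3 : 4 * (a * b) ≤ S ^ 2 * (1 - Φ ^ 2) + 2 * ε * S := by
    have hΦs : Φ * (a + b) ≤ a + b := by nlinarith
    have e1 : (Φ * (a + b) - (a - b)) * (Φ * (a + b) + (a - b)) ≤
        (Φ * (a + b) - (a - b)) * (2 * (a + b)) :=
      mul_le_mul_of_nonneg_left (by linarith) (by linarith)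
    have e2 : (Φ * (a + b) - (a - b)) * (2 * (a + b)) ≤ ε * (2 * S) := by gcongr
    have e3 : (a + b) ^ 2 * (1 - Φ ^ 2) ≤ S ^ 2 * (1 - Φ ^ 2) := by
      gcongr
      nlinarith
    linarith
  have h4 := mul_le_mul_of_nonneg_left h3 (by positivity : 0 ≤ 2 * Φ * δ * α)
  linarith

/-- Maximum principle for `u + v`. -/
theorem sq_mul_le_of_isLUB_add (h : IsPositiveRegularSolution N α ω u v) (hα : 0 < α)
    (hω : 0 < ω) {Φ γ S : ℝ} (hγ0 : 0 ≤ γ) (hγ : α - 2 ≤ γ) (hc : 0 ≤ 2 + α - Φ ^ 2 * γ)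
    (hS : IsLUB (Set.range (u + v)) S)
    (hle : ∀ x, |u x - v x| ≤ Φ * (u x + v x)) :
    S ^ 2 * (2 + α - Φ ^ 2 * γ) ≤ 4 * (1 + ω) := by
  obtain ⟨δ, hδ0, hδ⟩ := h.exists_le_add hα hω
  have hSle : ∀ x, (u + v) x ≤ S := fun x => hS.1 ⟨x, rfl⟩
  set c : ℝ := 2 + α - Φ ^ 2 * γ with hcdef
  suffices δ * (S ^ 2 * c) ≤ δ * (4 * (1 + ω)) from le_of_mul_le_mul_left this hδ0
  refine le_of_forall_le_add_mul (c := 4 + 2 * S * δ * c) fun ε hε => ?_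
  obtain ⟨_, ⟨y, rfl⟩, hy, -⟩ := hS.exists_between (sub_lt_self S hε)
  obtain ⟨x, hyx, hx⟩ := h.contDiff_add.exists_le_and_laplacian_le hSle y hε
  rw [h.laplacian_add] at hx
  have hxS := hSle x
  have hxδ := hδ x
  have hd2 : (u x - v x) ^ 2 ≤ (Φ * (u x + v x)) ^ 2 :=
    sq_le_sq' (by linarith [neg_abs_le (u x - v x), hle x]) ((le_abs_self _).trans (hle x))
  have hxε : S - ε ≤ (u + v) x := by linarith
  rw [Pi.add_apply] at hxS hxε
  generalize u x = a at *
  generalize v x = b at *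
  have hB : δ * (a ^ 2 + b ^ 2 + α * (a * b) - 1 - ω) ≤ ε := by
    rcases le_total 0 (a ^ 2 + b ^ 2 + α * (a * b) - 1 - ω) with h0 | h0
    · exact (mul_le_mul_of_nonneg_right hxδ h0).trans hx
    · exact (mul_nonpos_of_nonneg_of_nonpos hδ0.le h0).trans hε.le
  -- Since `4 (a² + b² + αab) = (2 + α) s² - (α - 2) d²`, an upper bound on `d²` helps only after `α
  -- - 2` is replaced by a nonnegative `γ`.
  have h1 : (a - b) ^ 2 * (α - 2) ≤ (a + b) ^ 2 * (Φ ^ 2 * γ) :=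
    calc (a - b) ^ 2 * (α - 2) ≤ (a - b) ^ 2 * γ := by gcongr
      _ ≤ (Φ * (a + b)) ^ 2 * γ := by gcongr
      _ = _ := by ring
  have h2 : (a + b) ^ 2 * c ≤ 4 * (1 + ω) + 4 * (a ^ 2 + b ^ 2 + α * (a * b) - 1 - ω) := by
    rw [hcdef]
    linarith
  have h3 := mul_le_mul_of_nonneg_left h2 hδ0.le
  have h4 : S ^ 2 ≤ (a + b) ^ 2 + 2 * S * ε := by nlinarith
  have h5 := mul_le_mul_of_nonneg_left h4 (mul_nonneg hδ0.le hc)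
  linarith

/-- Minimum principle for `u + v` on the diagonal. -/
theorem le_sq_mul_of_isGLB_add (h : IsPositiveRegularSolution N α ω u v) (hα : 0 < α)
    (hω : 0 < ω) {I : ℝ} (hI : IsGLB (Set.range (u + v)) I) (huv : ∀ x, u x = v x) :
    4 * (1 + ω) ≤ I ^ 2 * (2 + α) := by
  obtain ⟨δ, hδ0, hδ⟩ := h.exists_le_add hα hω
  obtain ⟨K, hK⟩ := h.exists_add_le hα hω
  have hIle : ∀ x, I ≤ (u + v) x := fun x => hI.1 ⟨x, rfl⟩
  have hδI : δ ≤ I := hI.2 (by rintro _ ⟨x, rfl⟩; exact hδ x)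
  suffices δ * (4 * (1 + ω)) ≤ δ * (I ^ 2 * (2 + α)) from le_of_mul_le_mul_left this hδ0
  refine le_of_forall_le_add_mul (c := 4 + 2 * K * δ * (2 + α)) fun ε hε => ?_
  obtain ⟨_, ⟨y, rfl⟩, -, hy⟩ := hI.exists_between (lt_add_of_pos_right I hε)
  obtain ⟨x, hyx, hx⟩ := h.contDiff_add.neg.exists_le_and_laplacian_le (K := 0)
    (fun x => neg_nonpos.2 (h.add_pos x).le) y hε
  have hneg : Laplacian.laplacian (fun x => -(u + v) x) x = -Laplacian.laplacian (u + v) x := by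
    exact congrFun (InnerProductSpace.laplacian_neg (f := u + v)) x
  rw [hneg, h.laplacian_add] at hx
  have hxI := hIle x
  have hxδ := hδ x
  have hxK := hK x
  have hxε : (u + v) x ≤ I + ε := by linarith [neg_le_neg_iff.1 hyx]
  rw [Pi.add_apply] at hxI hxε
  rw [← huv x] at *
  generalize u x = a at *
  have hB : δ * -(a ^ 2 + a ^ 2 + α * (a * a) - 1 - ω) ≤ ε := by
    rcases le_total 0 (-(a ^ 2 + a ^ 2 + α * (a * a) - 1 - ω)) with h0 | h0
    · exact (mul_le_mul_of_nonneg_right hxδ h0).trans (by linarith)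
    · exact (mul_nonpos_of_nonneg_of_nonpos hδ0.le h0).trans hε.le
  have h4 : (a + a) ^ 2 ≤ I ^ 2 + 2 * K * ε := by nlinarith
  have h5 := mul_le_mul_of_nonneg_left h4 (by positivity : 0 ≤ δ * (2 + α))
  linarith

/-! ### Symmetry `u = v` and the constant value. -/

theorem fst_eq_snd (h : IsPositiveRegularSolution N α ω u v) (hα : 0 < α) (hω : α ≤ 2 * ω) (x) :
    u x = v x := by
  have hω0 : 0 < ω := by linarith
  obtain ⟨K, hK⟩ := h.exists_add_le hα hω0
  have hpos : ∀ x, 0 < u x + v x := h.add_pos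
  obtain ⟨S, hS⟩ := Real.exists_isLUB (Set.range_nonempty (u + v))
    ⟨K, by rintro _ ⟨x, rfl⟩; exact hK x⟩
  have hSle : ∀ x, u x + v x ≤ S := fun x => hS.1 ⟨x, rfl⟩
  have hS0 : 0 < S := (hpos 0).trans_le (hSle 0)
  have hratio : ∀ x, |u x - v x| / (u x + v x) ≤ 1 := fun x => by
    rw [div_le_one (hpos x), abs_le]
    constructor <;> linarith [h.pos_fst x, h.pos_snd x]
  obtain ⟨Φ, hΦ⟩ := Real.exists_isLUB (Set.range_nonempty fun x => |u x - v x| / (u x + v x))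
    ⟨1, by rintro _ ⟨x, rfl⟩; exact hratio x⟩
  have hΦ1 : Φ ≤ 1 := hΦ.2 (by rintro _ ⟨x, rfl⟩; exact hratio x)
  have hle : ∀ x, |u x - v x| ≤ Φ * (u x + v x) := fun x => by
    rw [← div_le_iff₀ (hpos x)]
    exact hΦ.1 ⟨x, rfl⟩
  have hΦ0 : 0 ≤ Φ := (div_nonneg (abs_nonneg _) (hpos 0).le).trans (hΦ.1 ⟨0, rfl⟩)
  rcases hΦ0.eq_or_lt with h0 | h0
  · have := hle x
    rw [← h0, zero_mul] at this
    exact sub_eq_zero.1 (abs_nonpos_iff.1 this)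
  exfalso
  have hsup : ∀ ε, 0 < ε → ∃ x, Φ * (u x + v x) - ε < |u x - v x| := fun ε hε => by
    obtain ⟨_, ⟨y, rfl⟩, hy, -⟩ := hΦ.exists_between (sub_lt_self Φ (div_pos hε hS0))
    refine ⟨y, ?_⟩
    rw [lt_div_iff₀ (hpos y)] at hy
    have : ε / S * (u y + v y) ≤ ε := by
      rw [div_mul_eq_mul_div, div_le_iff₀ hS0]
      exact mul_le_mul_of_nonneg_left (hSle y) hε.le
    linarith
  have h1 : 4 * ω ≤ α * (S ^ 2 * (1 - Φ ^ 2)) := by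
    -- If `u - v` stays a fixed `ε₀` below `Φ (u + v)`, then `v - u` must come arbitrarily close to
    -- it, and exchanging `u` and `v` applies.
    by_cases hcase : ∀ ε, 0 < ε → ∃ x, Φ * (u x + v x) - ε < u x - v x
    · exact h.four_mul_le_of_ratio_sup hα hω0 h0 hΦ1 hSle
        (fun x => (le_abs_self _).trans (hle x)) hcase
    · push Not at hcase
      obtain ⟨ε₀, hε₀, hcase⟩ := hcase
      refine h.swap.four_mul_le_of_ratio_sup hα hω0 h0 hΦ1 (fun x => by linarith [hSle x])
        (fun x => ?_) fun ε hε => ?_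
      · have := (neg_le_abs _).trans (hle x)
        linarith
      · obtain ⟨y, hy⟩ := hsup (min ε ε₀) (lt_min hε hε₀)
        refine ⟨y, ?_⟩
        have hy1 := hcase y
        have := min_le_left ε ε₀
        have := min_le_right ε ε₀
        rcases abs_choice (u y - v y) with he | he <;> rw [he] at hy <;> linarith
  have hγα : max (α - 2) 0 ≤ α := max_le (by linarith) hα.le
  have hγ0 : 0 ≤ max (α - 2) 0 := le_max_right _ _
  have hγ : α - 2 ≤ max (α - 2) 0 := le_max_left _ _
  generalize max (α - 2) 0 = γ at *
  have hΦsq : Φ ^ 2 ≤ 1 := by nlinarith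
  have hc : 0 < 2 + α - Φ ^ 2 * γ := by nlinarith
  have h2 := h.sq_mul_le_of_isLUB_add hα hω0 hγ0 hγ hc.le hS hle
  have h3 := mul_le_mul_of_nonneg_right h1 hc.le
  have h4 := mul_le_mul_of_nonneg_left h2 (mul_nonneg hα.le (sub_nonneg.2 hΦsq))
  have h5 : 0 ≤ ω * Φ ^ 2 * (α - γ) := mul_nonneg (by positivity) (by linarith)
  have h6 : 0 < α * Φ ^ 2 := by positivity
  -- Eliminating `S` gives `(2ω - α) + αΦ² + ωΦ² (α - γ) ≤ 0`, whose middle term is positive and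
  -- whose other terms are nonnegative.
  linarith

end IsPositiveRegularSolution

theorem theorem1p3 (N : ℕ) (hN : 1 ≤ N) (α ω : ℝ) (hα : 0 < α) (hω : 1 / 2 ≤ ω / α)
    (u v : EuclideanSpace ℝ (Fin N) → ℝ) (h : IsPositiveRegularSolution N α ω u v) :
    ∀ x, u x = √((1 + ω) / (2 + α)) ∧ v x = √((1 + ω) / (2 + α)) := by
  intro x
  have hω' : α ≤ 2 * ω := by
    rw [le_div_iff₀ hα] at hω
    linarith
  have hω0 : 0 < ω := by linarith
  have huv := h.fst_eq_snd hα hω'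
  obtain ⟨K, hK⟩ := h.exists_add_le hα hω0
  obtain ⟨S, hS⟩ := Real.exists_isLUB (Set.range_nonempty (u + v))
    ⟨K, by rintro _ ⟨x, rfl⟩; exact hK x⟩
  obtain ⟨I, hI⟩ := Real.exists_isGLB (Set.range_nonempty (u + v))
    ⟨0, by rintro _ ⟨x, rfl⟩; exact (h.add_pos x).le⟩
  have hI0 : 0 ≤ I := hI.2 (by rintro _ ⟨x, rfl⟩; exact (h.add_pos x).le)
  -- With `Φ = 0` the value of `γ` drops out, so `γ = α` serves.
  have hup := h.sq_mul_le_of_isLUB_add hα hω0 (Φ := 0) hα.le (by linarith) (by simp; linarith) hS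
    fun x => by simp [huv x]
  have hlow := h.le_sq_mul_of_isGLB_add hα hω0 hI huv
  have hIx : I ≤ u x + v x := hI.1 ⟨x, rfl⟩
  have hSx : u x + v x ≤ S := hS.1 ⟨x, rfl⟩
  have hu := h.pos_fst x
  rw [← huv x] at hIx hSx ⊢
  have h1 : (u x + u x) ^ 2 ≤ S ^ 2 := by gcongr
  have h2 : I ^ 2 ≤ (u x + u x) ^ 2 := by gcongr
  have hsq : (1 + ω) / (2 + α) = u x ^ 2 := by
    rw [div_eq_iff (by positivity)]
    have := mul_le_mul_of_nonneg_right h1 (by linarith : 0 ≤ 2 + α)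
    have := mul_le_mul_of_nonneg_right h2 (by linarith : 0 ≤ 2 + α)
    linarith
  rw [hsq, Real.sqrt_sq hu.le]
  exact ⟨rfl, rfl⟩
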